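/- For all integers $1\le K_c\le N$ and $M\ge 1$, let $\Phi\in\mathbb{R}^{M\times N}$ be a random matrix with independent rows such that, for each row, the support (the set of positions of its nonzero entries) is uniformly distributed over the $\binom{N}{K_c}$ subsets of $\{1,\dots,N\}$ of size $K_c$ and, conditionally on the support, the nonzero entries are independent and equal to $+1$ or $-1$ with probability $1/2$ each. For a matrix $A\in\mathbb{R}^{M\times N}$, the restricted isometry constant $\delta_K(A)$ of order $K$ is the smallest $\delta_K\ge 0$ such that $$(1-\delta_K)\|x\|_2^2\le\|Ax\|_2^2\le(1+\delta_K)\|x\|_2^2$$ for all $x\in\mathbb{R}^N$ with at most $K$ nonzero entries. Theorem. For every $\rho>0$ there are constants $C,c>0$, depending only on $\rho$, such that the following holds whenever $K_c/N\ge\rho$. For every sparsity level $1\le K\le N$ and every $\delta\in(0,1)$, if $$M\ge C\delta^{-2}K\log\left(\frac{eN}{K}\right),$$ then the scaled matrix $A=\sqrt{\frac{N}{K_cM}}\,\Phi$ satisfies the restricted isometry property of order $K$ with constant $\delta_K(A)\le\delta$, with probability exceeding $1-2\exp(-c\delta^2M)$. -/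

import Mathlib

open MeasureTheory ProbabilityTheory
open scoped Matrix ENNReal

/-- `δ ≥ 0` is admissible for the restricted isometry property of order `K` of `A`:
`(1 - δ) ‖x‖₂² ≤ ‖A x‖₂² ≤ (1 + δ) ‖x‖₂²` for every `x` with at most `K` nonzero entries. -/
def SatisfiesRIP {M N : ℕ} (A : Matrix (Fin M) (Fin N) ℝ) (K : ℕ) (δ : ℝ) : Prop :=
  0 ≤ δ ∧ ∀ x : Fin N → ℝ, (Function.support x).ncard ≤ K →
    (1 - δ) * ‖WithLp.toLp 2 x‖ ^ 2 ≤ ‖WithLp.toLp 2 (A *ᵥ x)‖ ^ 2 ∧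
      ‖WithLp.toLp 2 (A *ᵥ x)‖ ^ 2 ≤ (1 + δ) * ‖WithLp.toLp 2 x‖ ^ 2

/-- `δK` is the restricted isometry constant of order `K` of `A`, that is, the smallest number
with which `A` satisfies the restricted isometry property of order `K`. -/
def IsRestrictedIsometryConstant {M N : ℕ} (A : Matrix (Fin M) (Fin N) ℝ) (K : ℕ) (δK : ℝ) :
    Prop :=
  IsLeast {δ : ℝ | SatisfiesRIP A K δ} δK

/-- The random vector `q` in `ℝ^N` has a support that is uniformly distributed over the subsets of
`{1, …, N}` of size `k` and, conditionally on the support being `T`, its entries indexed by `T`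
are independent and equal to `+1` or `-1` with probability `1/2` each. -/
structure IsSparseSignVector {Ω : Type*} [MeasurableSpace Ω] (μ : Measure Ω) {N : ℕ} (k : ℕ)
    (q : Ω → Fin N → ℝ) : Prop where
  measurable : Measurable q
  support_uniform : ∀ T : Finset (Fin N), T.card = k →
    μ {ω | Function.support (q ω) = (T : Set (Fin N))} = ((N.choose k : ℕ) : ℝ≥0∞)⁻¹
  signs_indep : ∀ T : Finset (Fin N), T.card = k →
    iIndepFun (fun (j : {j // j ∈ T}) (ω : Ω) => q ω j)
      (cond μ {ω | Function.support (q ω) = (T : Set (Fin N))})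
  signs_symm : ∀ T : Finset (Fin N), T.card = k → ∀ j ∈ T,
    cond μ {ω | Function.support (q ω) = (T : Set (Fin N))} {ω | q ω j = 1} = 2⁻¹ ∧
      cond μ {ω | Function.support (q ω) = (T : Set (Fin N))} {ω | q ω j = -1} = 2⁻¹

/-- A random matrix whose rows are independent sparse sign vectors with `k` nonzero entries. -/
structure IsSparseSensingMatrix {Ω : Type*} [MeasurableSpace Ω] (μ : Measure Ω) {M N : ℕ} (k : ℕ)
    (Φ : Ω → Matrix (Fin M) (Fin N) ℝ) : Prop where
  rows : ∀ i, IsSparseSignVector μ k (fun ω => (Φ ω i : Fin N → ℝ))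
  rows_indep : iIndepFun (fun (i : Fin M) (ω : Ω) => (Φ ω i : Fin N → ℝ)) μ

/-! Fix a unit vector `x`. Given its support, a row `q` pairs with `x` to a weighted sum of
independent signs, which is subgaussian with parameter at most 1 whatever the support. Averaging
over supports keeps this bound (`IsSparseSignVector.hasSubgaussianMGF`) and gives second moment `k /
N` (`IsSparseSignVector.integral_sq`). Squares of subgaussian variables satisfy a Bernstein-type mgf
bound near zero (`HasSubgaussianMGF.mgf_sq_le`), so Chernoff over the independent rows makes `‖A
x‖²` concentrate at 1, with failure probability exponentially small in `(k / N)² δ² M`.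

To pass to all sparse vectors, take a 1/2-net of at most `5 ^ K` points on the unit sphere of each
`K`-dimensional coordinate subspace. Control of the quadratic form `‖A x‖² - ‖x‖²` on the net
controls it on the subspace up to a factor 32 (`abs_norm_sq_map_sub_norm_sq_le_of_net`). The union
bound costs `N.choose K * 5 ^ K`, which the lower bound on `M` absorbs. -/

/-! ### Concentration of sums of squares of subgaussian variables -/

theorem Real.exp_le_one_add_add_sq_mul_exp_abs (y : ℝ) :
    Real.exp y ≤ 1 + y + y ^ 2 * Real.exp |y| := by
  have h1 : 1 ≤ Real.exp |y| := Real.one_le_exp (abs_nonneg y)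
  rcases le_or_gt |y| 1 with h | h
  · have := (abs_le.1 (Real.abs_exp_sub_one_sub_id_le h)).2
    nlinarith [mul_le_mul_of_nonneg_left h1 (sq_nonneg y)]
  · rcases lt_abs.1 h with h | h
    · rw [abs_of_pos (by linarith)] at *
      nlinarith [mul_le_mul_of_nonneg_right (show 1 ≤ y ^ 2 by nlinarith) (Real.exp_pos y).le]
    · have : Real.exp y ≤ 1 := Real.exp_le_one_iff.2 (by linarith)
      nlinarith [mul_le_mul_of_nonneg_left h1 (sq_nonneg y)]

theorem lintegral_exp_sq_div_four_gaussianReal :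
    ∫⁻ g, ENNReal.ofReal (Real.exp (g ^ 2 / 4)) ∂(gaussianReal 0 1) ≤ 2 := by
  rw [gaussianReal_of_var_ne_zero _ one_ne_zero,
    lintegral_withDensity_eq_lintegral_mul _ (measurable_gaussianPDF _ _) (by fun_prop)]
  -- The tilted standard density is `√2` times the density of variance 2, so the integral equals
  -- `√2`.
  have h : ∀ g : ℝ, (gaussianPDF 0 1 * fun g => ENNReal.ofReal (Real.exp (g ^ 2 / 4))) g =
      ENNReal.ofReal √2 * gaussianPDF 0 2 g := by
    intro g
    simp only [Pi.mul_apply, gaussianPDF, gaussianPDFReal]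
    rw [← ENNReal.ofReal_mul (by positivity), ← ENNReal.ofReal_mul (by positivity), mul_assoc,
      ← Real.exp_add]
    congr 1
    have h2 : √(2 * Real.pi * 2) = √(2 * Real.pi) * √2 := Real.sqrt_mul (by positivity) _
    simp only [NNReal.coe_one, mul_one, NNReal.coe_ofNat, h2, sub_zero]
    have : -g ^ 2 / 2 + g ^ 2 / 4 = -g ^ 2 / (2 * 2) := by ring
    rw [this]
    field_simp
  simp_rw [h]
  rw [lintegral_const_mul _ (measurable_gaussianPDF _ _),
    lintegral_gaussianPDF_eq_one _ two_ne_zero, mul_one]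
  rw [show (2 : ℝ≥0∞) = ENNReal.ofReal 2 by simp]
  refine ENNReal.ofReal_le_ofReal (Real.sqrt_le_iff.2 (by norm_num))

theorem exp_sq_div_four_eq_lintegral (y : ℝ) :
    ENNReal.ofReal (Real.exp (y ^ 2 / 4)) =
      ∫⁻ g, ENNReal.ofReal (Real.exp (g * y / √2)) ∂(gaussianReal 0 1) := by
  have h := mgf_gaussianReal (p := gaussianReal 0 1) (X := id) (μ := 0) (v := 1) (by simp) (y / √2)
  have hi : Integrable (fun g => Real.exp (y / √2 * g)) (gaussianReal 0 1) :=
    integrable_exp_mul_gaussianReal _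
  have : ∀ g : ℝ, g * y / √2 = y / √2 * g := fun g => by ring
  simp_rw [this]
  rw [← ofReal_integral_eq_lintegral_ofReal hi (by filter_upwards with g using (Real.exp_pos _).le)]
  simp only [mgf, id] at h
  rw [h]
  congr 2
  rw [div_pow, Real.sq_sqrt (by norm_num)]
  simp; ring

/-- Decoupling by an auxiliary Gaussian `g`: writing `exp (Y² / 4)` as the `g`-average of `exp (g Y
/ √2)` makes the exponent linear in `Y`. After Tonelli the subgaussian bound leaves the `g`-average
of `exp (g² / 4)`. -/
theorem ProbabilityTheory.HasSubgaussianMGF.lintegral_exp_sq_le {Ω : Type*} [MeasurableSpace Ω]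
    {μ : Measure Ω} [IsProbabilityMeasure μ] {Y : Ω → ℝ} (hY : HasSubgaussianMGF Y 1 μ)
    (hm : Measurable Y) :
    ∫⁻ ω, ENNReal.ofReal (Real.exp (Y ω ^ 2 / 4)) ∂μ ≤ 2 := by
  simp_rw [exp_sq_div_four_eq_lintegral]
  rw [lintegral_lintegral_swap (by fun_prop)]
  refine le_trans (lintegral_mono fun g => ?_) lintegral_exp_sq_div_four_gaussianReal
  have : ∀ ω, g * Y ω / √2 = g / √2 * Y ω := fun g => by ring
  simp_rw [this]
  rw [← ofReal_integral_eq_lintegral_ofReal (hY.integrable_exp_mul _)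
    (by filter_upwards with g using (Real.exp_pos _).le)]
  refine ENNReal.ofReal_le_ofReal ((hY.mgf_le (g / √2)).trans (le_of_eq ?_))
  congr 1
  rw [div_pow, Real.sq_sqrt (by norm_num)]
  simp; ring

theorem ProbabilityTheory.HasSubgaussianMGF.integrable_exp_sq {Ω : Type*} [MeasurableSpace Ω]
    {μ : Measure Ω} [IsProbabilityMeasure μ] {Y : Ω → ℝ} (hY : HasSubgaussianMGF Y 1 μ)
    (hm : Measurable Y) : Integrable (fun ω => Real.exp (Y ω ^ 2 / 4)) μ := by
  refine ⟨by fun_prop, ?_⟩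
  rw [hasFiniteIntegral_iff_ofReal (by filter_upwards with g using (Real.exp_pos _).le)]
  exact (hY.lintegral_exp_sq_le hm).trans_lt (by simp)

theorem ProbabilityTheory.HasSubgaussianMGF.integral_exp_sq_le {Ω : Type*} [MeasurableSpace Ω]
    {μ : Measure Ω} [IsProbabilityMeasure μ] {Y : Ω → ℝ} (hY : HasSubgaussianMGF Y 1 μ)
    (hm : Measurable Y) : ∫ ω, Real.exp (Y ω ^ 2 / 4) ∂μ ≤ 2 := by
  rw [integral_eq_lintegral_of_nonneg_ae (by filter_upwards with g using (Real.exp_pos _).le)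
    (by fun_prop)]
  exact ENNReal.toReal_le_of_le_ofReal (by norm_num) (by simpa using hY.lintegral_exp_sq_le hm)

theorem ProbabilityTheory.HasSubgaussianMGF.integrable_exp_mul_sq {Ω : Type*} [MeasurableSpace Ω]
    {μ : Measure Ω} [IsProbabilityMeasure μ] {Y : Ω → ℝ} (hY : HasSubgaussianMGF Y 1 μ)
    (hm : Measurable Y) {t : ℝ} (ht : |t| ≤ 1 / 8) :
    Integrable (fun ω => Real.exp (t * Y ω ^ 2)) μ := by
  refine (hY.integrable_exp_sq hm).mono (by fun_prop) ?_
  filter_upwards with ω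
  rw [Real.norm_of_nonneg (Real.exp_pos _).le, Real.norm_of_nonneg (Real.exp_pos _).le]
  gcongr
  nlinarith [sq_nonneg (Y ω), (abs_le.1 ht).2]

theorem ProbabilityTheory.HasSubgaussianMGF.mgf_sq_le {Ω : Type*} [MeasurableSpace Ω]
    {μ : Measure Ω} [IsProbabilityMeasure μ] {Y : Ω → ℝ} (hY : HasSubgaussianMGF Y 1 μ)
    (hm : Measurable Y) {t : ℝ} (ht : |t| ≤ 1 / 8) :
    mgf (fun ω => Y ω ^ 2) μ t ≤ Real.exp (t * ∫ ω, Y ω ^ 2 ∂μ + 256 * t ^ 2) := by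
  have hL : Integrable (fun ω => Y ω ^ 2) μ := (hY.memLp 2).integrable_sq
  have hE := hY.integrable_exp_sq hm
  have key : ∀ ω, Real.exp (t * Y ω ^ 2) ≤
      1 + t * Y ω ^ 2 + 128 * t ^ 2 * Real.exp (Y ω ^ 2 / 4) := by
    intro ω
    refine (Real.exp_le_one_add_add_sq_mul_exp_abs _).trans ?_
    set z := Y ω ^ 2
    have hz : 0 ≤ z := sq_nonneg _
    have h1 : Real.exp |t * z| ≤ Real.exp (z / 8) := by
      rw [abs_mul, abs_of_nonneg hz]; gcongr; nlinarith
    -- The quadratic Taylor term of `exp (z / 8)` is `z² / 128`; the final 256 is this 128 times the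
    -- bound 2 on the mean of `exp (Y² / 4)`.
    have h2 : z ^ 2 ≤ 128 * Real.exp (z / 8) := by
      have := Real.quadratic_le_exp_of_nonneg (x := z / 8) (by positivity)
      nlinarith
    have h3 : Real.exp (z / 4) = Real.exp (z / 8) * Real.exp (z / 8) := by
      rw [← Real.exp_add]; congr 1; ring
    have : z ^ 2 * Real.exp |t * z| ≤ 128 * Real.exp (z / 4) := by
      rw [h3, ← mul_assoc]; gcongr
    rw [mul_pow]
    nlinarith [mul_le_mul_of_nonneg_left this (sq_nonneg t)]
  have : mgf (fun ω => Y ω ^ 2) μ t ≤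
      ∫ ω, (1 + t * Y ω ^ 2 + 128 * t ^ 2 * Real.exp (Y ω ^ 2 / 4)) ∂μ :=
    integral_mono (hY.integrable_exp_mul_sq hm ht) (by fun_prop) key
  rw [integral_add (by fun_prop) (by fun_prop), integral_add (by fun_prop) (by fun_prop),
    integral_const_mul, integral_const_mul] at this
  simp only [integral_const, probReal_univ, smul_eq_mul, mul_one] at this
  refine this.trans (le_trans ?_ (Real.add_one_le_exp _))
  nlinarith [mul_le_mul_of_nonneg_left (hY.integral_exp_sq_le hm) (sq_nonneg t)]

theorem measure_abs_sum_sq_sub_ge_le {Ω : Type*} [MeasurableSpace Ω]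
    {μ : Measure Ω} [IsProbabilityMeasure μ] {M : ℕ} {Y : Fin M → Ω → ℝ} {p ε : ℝ}
    (hY : ∀ i, HasSubgaussianMGF (Y i) 1 μ) (hm : ∀ i, Measurable (Y i)) (hind : iIndepFun Y μ)
    (hp : ∀ i, ∫ ω, Y i ω ^ 2 ∂μ = p) (hε : 0 ≤ ε) (hε1 : ε ≤ 1) :
    μ.real {ω | M * ε ≤ |∑ i, Y i ω ^ 2 - M * p|} ≤ 2 * Real.exp (-(M * ε ^ 2 / 1024)) := by
  have hindsq : iIndepFun (fun i ω => Y i ω ^ 2) μ :=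
    hind.comp (fun _ y => y ^ 2) (fun _ => by fun_prop)
  have hmgf : ∀ t : ℝ, |t| ≤ 1 / 8 →
      mgf (∑ i, fun ω => Y i ω ^ 2) μ t ≤ Real.exp (M * (t * p + 256 * t ^ 2)) := by
    intro t ht
    rw [hindsq.mgf_sum (fun i => by fun_prop)]
    refine (Finset.prod_le_prod (fun i _ => mgf_nonneg)
      (fun i _ => (hY i).mgf_sq_le (hm i) ht)).trans (le_of_eq ?_)
    simp [hp, Real.exp_nat_mul]
  have hint : ∀ t : ℝ, |t| ≤ 1 / 8 →
      Integrable (fun ω => Real.exp (t * (∑ i, fun ω => Y i ω ^ 2) ω)) μ := fun t ht =>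
    hindsq.integrable_exp_mul_sum (fun i => by fun_prop)
      fun i _ => (hY i).integrable_exp_mul_sq (hm i) ht
  -- The Chernoff parameter `t = ε / 512` minimises `256 t² - t ε`, with value `-ε² / 1024`.
  have ha : |ε / 512| ≤ 1 / 8 := by rw [abs_of_nonneg (by positivity)]; linarith
  have ha' : |-(ε / 512)| ≤ 1 / 8 := by rwa [abs_neg]
  have hu := measure_ge_le_exp_mul_mgf (μ := μ) (M * p + M * ε) (show 0 ≤ ε / 512 by positivity)
    (hint _ ha)
  have hl := measure_le_le_exp_mul_mgf (μ := μ) (M * p - M * ε)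
    (show -(ε / 512) ≤ 0 by linarith [show 0 ≤ ε / 512 by positivity]) (hint _ ha')
  have hu' := hu.trans (mul_le_mul_of_nonneg_left (hmgf _ ha) (Real.exp_pos _).le)
  have hl' := hl.trans (mul_le_mul_of_nonneg_left (hmgf _ ha') (Real.exp_pos _).le)
  rw [← Real.exp_add] at hu' hl'
  have hsub : {ω | M * ε ≤ |∑ i, Y i ω ^ 2 - M * p|} ⊆
      {ω | M * p + M * ε ≤ (∑ i, fun ω => Y i ω ^ 2) ω} ∪
        {ω | (∑ i, fun ω => Y i ω ^ 2) ω ≤ M * p - M * ε} := by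
    intro ω hω
    simp only [Set.mem_ofPred_eq, Set.mem_union, Finset.sum_apply] at hω ⊢
    rcases le_abs.1 hω with h | h
    · left; linarith
    · right; linarith
  refine (measureReal_mono hsub).trans ((measureReal_union_le _ _).trans ?_)
  refine (add_le_add hu' hl').trans (le_of_eq ?_)
  rw [two_mul]
  congr 2 <;> ring

/-! ### Nets on the sphere and quadratic forms -/

/-- A 1/2-separated subset of the sphere of maximal cardinality is a net. Doubling it gives a
1-separated set in the ball of radius 2, where the Besicovitch packing bound applies. -/
theorem exists_finset_half_net_sphere (E : Type*) [NormedAddCommGroup E] [NormedSpace ℝ E]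
    [FiniteDimensional ℝ E] :
    ∃ s : Finset E, s.card ≤ 5 ^ Module.finrank ℝ E ∧ (∀ y ∈ s, ‖y‖ = 1) ∧
      ∀ x : E, ‖x‖ = 1 → ∃ y ∈ s, ‖x - y‖ ≤ 1 / 2 := by
  classical
  let P : ℕ → Prop := fun n => ∃ s : Finset E, s.card = n ∧ (∀ y ∈ s, ‖y‖ = 1) ∧
    ∀ y ∈ s, ∀ z ∈ s, y ≠ z → 1 / 2 ≤ ‖y - z‖
  have hP : ∀ n, P n → n ≤ 5 ^ Module.finrank ℝ E := by
    rintro n ⟨s, rfl, h1, h2⟩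
    have hinj : Function.Injective (fun x : E => (2 : ℝ) • x) :=
      smul_right_injective E (two_ne_zero)
    rw [← Finset.card_image_of_injective s hinj]
    refine Besicovitch.card_le_of_separated _ ?_ ?_
    · simp only [Finset.mem_image, forall_exists_index, and_imp, forall_apply_eq_imp_iff₂]
      intro y hy
      rw [norm_smul, h1 y hy]; norm_num
    · simp only [Finset.mem_image, forall_exists_index, and_imp, forall_apply_eq_imp_iff₂]
      intro y hy z hz hyz
      rw [← smul_sub, norm_smul, Real.norm_ofNat]
      linarith [h2 y hy z hz (fun h => hyz (by rw [h]))]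
  have h0 : P 0 := ⟨∅, by simp⟩
  obtain ⟨s, hs, h1, h2⟩ := Nat.findGreatest_spec (P := P) (Nat.zero_le _) h0
  refine ⟨s, hs ▸ hP _ ⟨s, hs, h1, h2⟩, h1, fun x hx => ?_⟩
  by_contra! hcon
  have hxs : x ∉ s := fun h => by
    have := hcon x h
    norm_num at this
  have hins : P (s.card + 1) := by
    refine ⟨insert x s, Finset.card_insert_of_notMem hxs, ?_, ?_⟩
    · simpa [hx] using h1
    · intro y hy z hz hyz
      rcases Finset.mem_insert.1 hy with hy | hy <;> rcases Finset.mem_insert.1 hz with hz | hz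
      · exact absurd (hy.trans hz.symm) hyz
      · exact hy ▸ (hcon z hz).le
      · rw [norm_sub_rev, hz]; exact (hcon y hy).le
      · exact h2 y hy z hz hyz
  have hle : s.card + 1 ≤ Nat.findGreatest P (5 ^ Module.finrank ℝ E) :=
    Nat.le_findGreatest (hP (s.card + 1) hins) hins
  exact absurd (hle.trans_eq hs.symm) (Nat.not_succ_le_self _)

/-- Let `D` be the maximum of `|Q|` on the sphere, attained at `x₀`, and `y` a net point near it.
Polarization gives `|Q x₀ - Q y| ≤ 31/32 D`, hence `D ≤ 31/32 D + δ/32` and `D ≤ δ`. -/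
theorem abs_norm_sq_map_sub_norm_sq_le_of_net {E F : Type*} [NormedAddCommGroup E]
    [InnerProductSpace ℝ E] [FiniteDimensional ℝ E] [NormedAddCommGroup F] [InnerProductSpace ℝ F]
    (L : E →ₗ[ℝ] F) {s : Finset E} (hs1 : ∀ y ∈ s, ‖y‖ = 1)
    (hs : ∀ x : E, ‖x‖ = 1 → ∃ y ∈ s, ‖x - y‖ ≤ 1 / 2) {δ : ℝ}
    (h : ∀ y ∈ s, |‖L y‖ ^ 2 - ‖y‖ ^ 2| ≤ δ / 32) (x : E) :
    |‖L x‖ ^ 2 - ‖x‖ ^ 2| ≤ δ * ‖x‖ ^ 2 := by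
  rcases eq_or_ne x 0 with rfl | hx
  · simp
  let Q : E → ℝ := fun x => ‖L x‖ ^ 2 - ‖x‖ ^ 2
  have hQs : ∀ (c : ℝ) x, Q (c • x) = c ^ 2 * Q x := by
    intro c x
    simp only [Q, map_smul, norm_smul, mul_pow, Real.norm_eq_abs, sq_abs]; ring
  have hunit : ∀ y : E, y ≠ 0 → ‖‖y‖⁻¹ • y‖ = 1 := fun y hy => norm_smul_inv_norm (𝕜 := ℝ) hy
  have hLc : Continuous L := L.continuous_of_finiteDimensional
  obtain ⟨x₀, hx₀, hmax⟩ := (isCompact_sphere (0 : E) 1).exists_isMaxOn (f := fun x => |Q x|)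
    ⟨‖x‖⁻¹ • x, by simpa using hunit x hx⟩ (by fun_prop)
  have hx₀1 : ‖x₀‖ = 1 := by simpa using hx₀
  set D := |Q x₀| with hD
  have hD0 : 0 ≤ D := abs_nonneg _
  have hbound : ∀ y, |Q y| ≤ D * ‖y‖ ^ 2 := by
    intro y
    rcases eq_or_ne y 0 with rfl | hy
    · simp [Q]
    have h1 : |Q (‖y‖⁻¹ • y)| ≤ D := hmax (by simpa using hunit y hy)
    rw [hQs, abs_mul, abs_of_nonneg (sq_nonneg _)] at h1
    have hn : 0 < ‖y‖ := norm_pos_iff.2 hy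
    rw [inv_pow, inv_mul_le_iff₀ (by positivity)] at h1
    linarith
  obtain ⟨y, hy, hxy⟩ := hs x₀ hx₀1
  have hpar := parallelogram_law_with_norm ℝ x₀ y
  rw [hx₀1, hs1 y hy] at hpar
  -- The difference is the bilinear form at `(x₀ - y, x₀ + y)`. The weights 2 and 1/2 leave it
  -- unchanged but balance the short and long vectors; unweighted polarization would only give `2
  -- D`.
  have hpol : Q x₀ - Q y =
      (Q ((2 : ℝ) • (x₀ - y) + (1 / 2 : ℝ) • (x₀ + y)) -
        Q ((2 : ℝ) • (x₀ - y) - (1 / 2 : ℝ) • (x₀ + y))) / 4 := by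
    simp only [Q, map_add, map_sub, map_smul, ← real_inner_self_eq_norm_sq, inner_add_left,
      inner_add_right, inner_sub_left, inner_sub_right, inner_smul_left, inner_smul_right,
      real_inner_comm y x₀, real_inner_comm (L y) (L x₀)]
    simp
    ring
  have h1 := hbound ((2 : ℝ) • (x₀ - y) + (1 / 2 : ℝ) • (x₀ + y))
  have h2 := hbound ((2 : ℝ) • (x₀ - y) - (1 / 2 : ℝ) • (x₀ + y))
  have hpar2 := parallelogram_law_with_norm ℝ ((2 : ℝ) • (x₀ - y)) ((1 / 2 : ℝ) • (x₀ + y))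
  rw [norm_smul, norm_smul, Real.norm_ofNat, show ‖(1 / 2 : ℝ)‖ = 1 / 2 by norm_num] at hpar2
  have hdiff : |Q x₀ - Q y| ≤ 31 / 32 * D := by
    rw [hpol, abs_div]
    have h3 := abs_sub (Q ((2 : ℝ) • (x₀ - y) + (1 / 2 : ℝ) • (x₀ + y)))
      (Q ((2 : ℝ) • (x₀ - y) - (1 / 2 : ℝ) • (x₀ + y)))
    have h4 : ‖x₀ - y‖ * ‖x₀ - y‖ ≤ 1 / 4 := by nlinarith [norm_nonneg (x₀ - y)]
    rw [abs_of_pos (show (0 : ℝ) < 4 by norm_num), div_le_iff₀ (by norm_num)]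
    -- With `a = ‖x₀ - y‖² ≤ 1/4`, the parallelogram law makes this sum `2 + 15 a / 2`.
    have h6 := mul_le_mul_of_nonneg_left
      (show ‖(2 : ℝ) • (x₀ - y) + (1 / 2 : ℝ) • (x₀ + y)‖ ^ 2 +
        ‖(2 : ℝ) • (x₀ - y) - (1 / 2 : ℝ) • (x₀ + y)‖ ^ 2 ≤ 31 / 8 by nlinarith) hD0
    linarith
  have h5 := h y hy
  have hDδ : D ≤ δ := by
    have : |Q x₀| ≤ |Q x₀ - Q y| + |Q y| := by
      simpa using abs_add_le (Q x₀ - Q y) (Q y)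
    have : |Q y| ≤ δ / 32 := h5
    linarith
  exact (hbound x).trans (by gcongr)

/-! ### Random signs and their weighted sums -/

section RademacherMeasure

variable {Ω : Type*} [MeasurableSpace Ω] {ν : Measure Ω} [IsProbabilityMeasure ν] {X : Ω → ℝ}

theorem ae_eq_one_or_eq_neg_one (hX : Measurable X) (h1 : ν {ω | X ω = 1} = 2⁻¹)
    (h2 : ν {ω | X ω = -1} = 2⁻¹) : ∀ᵐ ω ∂ν, X ω = 1 ∨ X ω = -1 := by
  have hm : ∀ a : ℝ, MeasurableSet {ω | X ω = a} := fun a => hX (measurableSet_singleton a)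
  have hu : ν ({ω | X ω = 1} ∪ {ω | X ω = -1}) = 1 := by
    rw [measure_union _ (hm _), h1, h2, ENNReal.inv_two_add_inv_two]
    refine Set.disjoint_left.2 fun ω h h' => ?_
    simp only [Set.mem_ofPred_eq] at h h'
    linarith
  exact (mem_ae_iff_prob_eq_one ((hm _).union (hm _))).2 hu

theorem integral_eq_zero_of_measure_eq_inv_two (hX : Measurable X)
    (h1 : ν {ω | X ω = 1} = 2⁻¹) (h2 : ν {ω | X ω = -1} = 2⁻¹) : ∫ ω, X ω ∂ν = 0 := by
  have hm : ∀ a : ℝ, MeasurableSet {ω | X ω = a} := fun a => hX (measurableSet_singleton a)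
  have h : X =ᵐ[ν] fun ω => {ω | X ω = 1}.indicator 1 ω - {ω | X ω = -1}.indicator 1 ω := by
    filter_upwards [ae_eq_one_or_eq_neg_one hX h1 h2] with ω hω
    rcases hω with hω | hω <;> simp [Set.indicator, hω] <;> norm_num
  rw [integral_congr_ae h, integral_sub, integral_indicator_one (hm _),
    integral_indicator_one (hm _), measureReal_def, measureReal_def, h1, h2, sub_self]
  · exact (integrable_const (1 : ℝ)).indicator (hm _)
  · exact (integrable_const (1 : ℝ)).indicator (hm _)

theorem hasSubgaussianMGF_one_of_measure_eq_inv_two (hX : Measurable X)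
    (h1 : ν {ω | X ω = 1} = 2⁻¹) (h2 : ν {ω | X ω = -1} = 2⁻¹) : HasSubgaussianMGF X 1 ν := by
  have h := hasSubgaussianMGF_of_mem_Icc_of_integral_eq_zero (μ := ν) (X := X) (a := -1) (b := 1)
    hX.aemeasurable ?_ (integral_eq_zero_of_measure_eq_inv_two hX h1 h2)
  · convert h using 1
    have : ‖(1 : ℝ) - -1‖₊ = 2 := by
      ext; norm_num
    rw [this]; norm_num
  · filter_upwards [ae_eq_one_or_eq_neg_one hX h1 h2] with ω hω
    rcases hω with hω | hω <;> rw [hω] <;> norm_num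

theorem integral_sq_eq_one_of_measure_eq_inv_two (hX : Measurable X)
    (h1 : ν {ω | X ω = 1} = 2⁻¹) (h2 : ν {ω | X ω = -1} = 2⁻¹) : ∫ ω, X ω ^ 2 ∂ν = 1 := by
  have h : (fun ω => X ω ^ 2) =ᵐ[ν] fun _ => 1 := by
    filter_upwards [ae_eq_one_or_eq_neg_one hX h1 h2] with ω hω
    rcases hω with hω | hω <;> simp [hω]
  simp [integral_congr_ae h]

end RademacherMeasure

theorem integral_sum_mul_sq_of_iIndepFun {Ω ι : Type*} [Fintype ι] [MeasurableSpace Ω]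
    {ν : Measure Ω} [IsProbabilityMeasure ν] {X : ι → Ω → ℝ} (hX : ∀ i, MemLp (X i) 2 ν)
    (hind : iIndepFun X ν) (h0 : ∀ i, ∫ ω, X i ω ∂ν = 0) (h1 : ∀ i, ∫ ω, X i ω ^ 2 ∂ν = 1)
    (x : ι → ℝ) : ∫ ω, (∑ i, x i * X i ω) ^ 2 ∂ν = ∑ i, x i ^ 2 := by
  have hind' : iIndepFun (fun i ω => x i * X i ω) ν :=
    hind.comp (fun i y => x i * y) (fun _ => by fun_prop)
  have hL : ∀ i, MemLp (fun ω => x i * X i ω) 2 ν := fun i => (hX i).const_mul _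
  have hz : ∀ i, ∫ ω, x i * X i ω ∂ν = 0 := fun i => by rw [integral_const_mul, h0, mul_zero]
  have hv := IndepFun.variance_sum (s := Finset.univ) (fun i _ => hL i)
    (fun i _ j _ hij => hind'.indepFun hij)
  have hsum : (∑ i, fun ω => x i * X i ω) = fun ω => ∑ i, x i * X i ω := by
    ext ω; simp
  rw [hsum, variance_of_integral_eq_zero] at hv
  · rw [hv]
    refine Finset.sum_congr rfl fun i _ => ?_
    rw [variance_of_integral_eq_zero (hL i).aemeasurable (hz i)]
    simp_rw [mul_pow]
    rw [integral_const_mul, h1, mul_one]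
  · exact (memLp_finsetSum _ fun i _ => hL i).aemeasurable
  · rw [integral_finsetSum _ fun i _ => (hL i).integrable (by norm_num)]
    simp [hz]

/-- Double counting: each index lies in `(N - 1).choose (k - 1)` of the `k`-subsets, a fraction `k /
N`. -/
theorem sum_powersetCard_sum_eq {N k : ℕ} (hk : 1 ≤ k) (hkN : k ≤ N) (f : Fin N → ℝ) :
    ((N.choose k : ℕ) : ℝ)⁻¹ * ∑ T ∈ Finset.powersetCard k (Finset.univ : Finset (Fin N)),
      ∑ j ∈ T, f j = k / N * ∑ j, f j := by
  have hT : ∀ T : Finset (Fin N), ∑ j ∈ T, f j = ∑ j, if j ∈ T then f j else 0 := fun T => by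
    rw [Finset.sum_ite_mem, Finset.univ_inter]
  rw [Finset.sum_congr rfl fun T _ => hT T, Finset.sum_comm]
  have hcount : ∀ j : Fin N, (∑ T ∈ Finset.powersetCard k (Finset.univ : Finset (Fin N)),
      if j ∈ T then f j else 0) = (N - 1).choose (k - 1) * f j := by
    intro j
    rw [← Finset.sum_filter, Finset.sum_const, nsmul_eq_mul]
    have := Finset.card_filter_powersetCard_subset {j} (Finset.univ : Finset (Fin N)) k
      (by simp) (by simpa using hk)
    simp only [Finset.singleton_subset_iff, Finset.card_univ, Fintype.card_fin,
      Finset.card_singleton] at this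
    rw [this]
  simp_rw [hcount]
  rw [← Finset.mul_sum, ← mul_assoc]
  congr 1
  obtain ⟨k, rfl⟩ := Nat.exists_eq_add_of_le' hk
  obtain ⟨N, rfl⟩ := Nat.exists_eq_add_of_le' (hk.trans hkN)
  have h := Nat.add_one_mul_choose_eq N k
  have h' : ((N : ℝ) + 1) * N.choose k = (N + 1).choose (k + 1) * (k + 1) := by exact_mod_cast h
  have hpos : (0 : ℝ) < (N + 1).choose (k + 1) := by exact_mod_cast Nat.choose_pos hkN
  simp only [Nat.add_sub_cancel]
  push_cast
  rw [inv_mul_eq_div, div_eq_div_iff hpos.ne' (by positivity)]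
  linarith

/-! ### Moments of one sparse sign row -/

section SparseSignVector

variable {Ω : Type*} [MeasurableSpace Ω] {μ : Measure Ω} {N k : ℕ}
  {q : Ω → Fin N → ℝ}

theorem measurableSet_support_eq (hq : Measurable q) (T : Finset (Fin N)) :
    MeasurableSet {ω | Function.support (q ω) = (T : Set (Fin N))} := by
  have : {ω | Function.support (q ω) = (T : Set (Fin N))} =
      ⋂ j : Fin N, {ω | q ω j ≠ 0 ↔ j ∈ T} := by
    ext ω
    simp [Set.ext_iff]
  rw [this]
  refine MeasurableSet.iInter fun j => ?_
  have hj : MeasurableSet {ω | q ω j ≠ 0} :=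
    ((measurable_pi_apply j).comp hq (measurableSet_singleton 0)).compl
  by_cases h : j ∈ T
  · simpa [h] using hj
  · have : {ω | q ω j ≠ 0 ↔ j ∈ T} = {ω | q ω j ≠ 0}ᶜ := by
      ext ω; simp [h]
    rw [this]
    exact hj.compl

theorem IsSparseSignVector.ae_sum_eq (hq : IsSparseSignVector μ k q) (x : Fin N → ℝ)
    (T : Finset (Fin N)) :
    (fun ω => ∑ j : {j // j ∈ T}, x j * q ω j) =ᵐ[cond μ {ω | Function.support (q ω) =
      (T : Set (Fin N))}] fun ω => ∑ j, x j * q ω j := by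
  filter_upwards [ae_cond_mem (measurableSet_support_eq hq.measurable T)] with ω hω
  rw [Finset.sum_coe_sort T (fun j => x j * q ω j)]
  refine Finset.sum_subset (Finset.subset_univ T) fun j _ hj => ?_
  have : j ∉ Function.support (q ω) := by
    rw [show Function.support (q ω) = (T : Set (Fin N)) from hω]; simpa using hj
  rw [Function.notMem_support.1 this, mul_zero]

variable [IsProbabilityMeasure μ]

theorem IsSparseSignVector.isProbabilityMeasure_cond (hq : IsSparseSignVector μ k q)
    {T : Finset (Fin N)} (hT : T.card = k) :
    IsProbabilityMeasure (cond μ {ω | Function.support (q ω) = (T : Set (Fin N))}) :=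
  cond_isProbabilityMeasure (by rw [hq.support_uniform T hT]; simp)

/-- The prescribed probabilities of the `k`-element supports already sum to 1, so every other
support is negligible. -/
theorem IsSparseSignVector.measure_eq_sum_cond (hq : IsSparseSignVector μ k q) (hkN : k ≤ N) :
    μ = ∑ T ∈ Finset.powersetCard k (Finset.univ : Finset (Fin N)), ((N.choose k : ℕ) : ℝ≥0∞)⁻¹ •
      cond μ {ω | Function.support (q ω) = (T : Set (Fin N))} := by
  set E : Finset (Fin N) → Set Ω := fun T => {ω | Function.support (q ω) = (T : Set (Fin N))}
  set P := Finset.powersetCard k (Finset.univ : Finset (Fin N))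
  have hEm : ∀ T, MeasurableSet (E T) := fun T => measurableSet_support_eq hq.measurable T
  have hne0 : ((N.choose k : ℕ) : ℝ≥0∞) ≠ 0 := by
    exact_mod_cast (Nat.choose_pos hkN).ne'
  have hnet : ((N.choose k : ℕ) : ℝ≥0∞) ≠ ∞ := ENNReal.natCast_ne_top _
  have hdisj : Pairwise (Function.onFun Disjoint E) := fun T T' hTT' =>
    Set.disjoint_left.2 fun ω h h' => hTT' (Finset.coe_injective (Eq.trans (Eq.symm h) h'))
  have hU : μ (⋃ T ∈ P, E T) = 1 := by
    rw [measure_biUnion_finset (fun T _ T' _ h => hdisj h) fun T _ => hEm T,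
      Finset.sum_congr rfl fun T hT => hq.support_uniform T (Finset.mem_powersetCard.1 hT).2]
    simp only [Finset.sum_const, Finset.card_powersetCard, Finset.card_univ, Fintype.card_fin,
      nsmul_eq_mul]
    exact ENNReal.mul_inv_cancel hne0 hnet
  ext s hs
  rw [Measure.finsetSum_apply]
  have h1 : μ s = μ (⋃ T ∈ P, E T ∩ s) := by
    rw [← Set.iUnion₂_inter]
    refine (measure_congr ?_).symm
    have : ∀ᵐ ω ∂μ, ω ∈ ⋃ T ∈ P, E T :=
      (mem_ae_iff_prob_eq_one (P.measurableSet_biUnion fun T _ => hEm T)).2 hU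
    filter_upwards [this] with ω hω
    exact propext ⟨fun h => h.2, fun h => ⟨hω, h⟩⟩
  rw [h1, measure_biUnion_finset (fun T _ T' _ h => (hdisj h).mono Set.inter_subset_left
    Set.inter_subset_left) fun T _ => (hEm T).inter hs]
  refine Finset.sum_congr rfl fun T hT => ?_
  rw [Measure.smul_apply, cond_apply (hEm T), hq.support_uniform T (Finset.mem_powersetCard.1 hT).2,
    inv_inv, smul_eq_mul, ← mul_assoc, ENNReal.inv_mul_cancel hne0 hnet, one_mul]

theorem IsSparseSignVector.integrable (hq : IsSparseSignVector μ k q) (hkN : k ≤ N) {f : Ω → ℝ}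
    (hf : ∀ T : Finset (Fin N), T.card = k →
      Integrable f (cond μ {ω | Function.support (q ω) = (T : Set (Fin N))})) :
    Integrable f μ := by
  rw [hq.measure_eq_sum_cond hkN]
  refine integrable_finsetSum_measure.2 fun T hT =>
    (hf T (Finset.mem_powersetCard.1 hT).2).smul_measure ?_
  simpa using (Nat.choose_pos hkN).ne'

theorem IsSparseSignVector.integral_eq (hq : IsSparseSignVector μ k q) (hkN : k ≤ N) {f : Ω → ℝ}
    (hf : ∀ T : Finset (Fin N), T.card = k →
      Integrable f (cond μ {ω | Function.support (q ω) = (T : Set (Fin N))})) :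
    ∫ ω, f ω ∂μ = ((N.choose k : ℕ) : ℝ)⁻¹ *
      ∑ T ∈ Finset.powersetCard k (Finset.univ : Finset (Fin N)),
        ∫ ω, f ω ∂(cond μ {ω | Function.support (q ω) = (T : Set (Fin N))}) := by
  conv_lhs => rw [hq.measure_eq_sum_cond hkN]
  rw [integral_finsetSum_measure]
  · simp [integral_smul_measure, Finset.mul_sum]
  · refine fun T hT => (hf T (Finset.mem_powersetCard.1 hT).2).smul_measure ?_
    simpa using (Nat.choose_pos hkN).ne'

/-- Independent signs with weights `x j`, `j ∈ T`, have parameter `∑ j ∈ T, x j ^ 2 ≤ 1`. Uniformity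
in `T` is what lets the bound survive averaging over supports. -/
theorem IsSparseSignVector.hasSubgaussianMGF_cond (hq : IsSparseSignVector μ k q)
    (x : Fin N → ℝ) (hx : ∑ j, x j ^ 2 = 1) {T : Finset (Fin N)} (hT : T.card = k) :
    (∀ t, Integrable (fun ω => Real.exp (t * ∑ j, x j * q ω j))
      (cond μ {ω | Function.support (q ω) = (T : Set (Fin N))})) ∧
    ∀ t, ∫ ω, Real.exp (t * ∑ j, x j * q ω j)
      ∂(cond μ {ω | Function.support (q ω) = (T : Set (Fin N))}) ≤ Real.exp (t ^ 2 / 2) := by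
  have := hq.isProbabilityMeasure_cond hT
  have hqm := hq.measurable
  have hm : ∀ j, Measurable fun ω => q ω j := fun j => (measurable_pi_apply j).comp hqm
  have hind : iIndepFun (fun (j : {j // j ∈ T}) ω => x j * q ω j) _ :=
    (hq.signs_indep T hT).comp (fun j y => x j * y) (fun _ => by fun_prop)
  have hj : ∀ j : {j // j ∈ T}, HasSubgaussianMGF (fun ω => x j * q ω j) (‖x j‖₊ ^ 2)
      (cond μ {ω | Function.support (q ω) = (T : Set (Fin N))}) := fun j => by
    convert (hasSubgaussianMGF_one_of_measure_eq_inv_two (hm j) (hq.signs_symm T hT j j.2).1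
      (hq.signs_symm T hT j j.2).2).const_mul (x j) using 1
    exact NNReal.eq ((sq_abs (x j)).trans (mul_one (x j ^ 2)).symm)
  have hs := (HasSubgaussianMGF.sum_of_iIndepFun (s := Finset.univ) hind fun j _ => hj j).congr
    (hq.ae_sum_eq x T)
  refine ⟨hs.integrable_exp_mul, fun t => (hs.mgf_le t).trans ?_⟩
  gcongr
  have : ((∑ j : {j // j ∈ T}, ‖x j‖₊ ^ 2 : NNReal) : ℝ) ≤ 1 := by
    push_cast
    simp only [Real.norm_eq_abs, sq_abs]
    rw [Finset.sum_coe_sort T (fun j => x j ^ 2), ← hx]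
    exact Finset.sum_le_sum_of_subset_of_nonneg (Finset.subset_univ T) fun _ _ _ => sq_nonneg _
  nlinarith [mul_le_mul_of_nonneg_right this (sq_nonneg t)]

theorem IsSparseSignVector.hasSubgaussianMGF (hq : IsSparseSignVector μ k q) (hkN : k ≤ N)
    {x : Fin N → ℝ} (hx : ∑ j, x j ^ 2 = 1) :
    HasSubgaussianMGF (fun ω => ∑ j, x j * q ω j) 1 μ where
  integrable_exp_mul t := hq.integrable hkN fun _ hT => (hq.hasSubgaussianMGF_cond x hx hT).1 t
  mgf_le t := by
    rw [mgf, hq.integral_eq hkN fun _ hT => (hq.hasSubgaussianMGF_cond x hx hT).1 t]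
    have hpos : (0 : ℝ) < N.choose k := by exact_mod_cast Nat.choose_pos hkN
    rw [inv_mul_le_iff₀ hpos]
    refine (Finset.sum_le_sum fun T hT =>
      (hq.hasSubgaussianMGF_cond x hx (Finset.mem_powersetCard.1 hT).2).2 t).trans (le_of_eq ?_)
    simp

theorem IsSparseSignVector.integral_sq (hq : IsSparseSignVector μ k q) (hk : 1 ≤ k) (hkN : k ≤ N)
    (x : Fin N → ℝ) :
    ∫ ω, (∑ j, x j * q ω j) ^ 2 ∂μ = k / N * ∑ j, x j ^ 2 := by
  have hqm := hq.measurable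
  have hm : ∀ j, Measurable fun ω => q ω j := fun j => (measurable_pi_apply j).comp hqm
  have hL : ∀ T : Finset (Fin N), T.card = k → ∀ j : {j // j ∈ T}, MemLp (fun ω => q ω j) 2
      (cond μ {ω | Function.support (q ω) = (T : Set (Fin N))}) := fun T hT j => by
    have := hq.isProbabilityMeasure_cond hT
    exact (hasSubgaussianMGF_one_of_measure_eq_inv_two (hm j) (hq.signs_symm T hT j j.2).1
      (hq.signs_symm T hT j j.2).2).memLp 2
  rw [hq.integral_eq hkN, ← sum_powersetCard_sum_eq hk hkN]
  · congr 1
    refine Finset.sum_congr rfl fun T hT => ?_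
    have hT := (Finset.mem_powersetCard.1 hT).2
    have := hq.isProbabilityMeasure_cond hT
    rw [← Finset.sum_coe_sort T (fun j => x j ^ 2),
      ← integral_sum_mul_sq_of_iIndepFun (hL T hT) (hq.signs_indep T hT)
      (fun j => integral_eq_zero_of_measure_eq_inv_two (hm j) (hq.signs_symm T hT j j.2).1
        (hq.signs_symm T hT j j.2).2)
      (fun j => integral_sq_eq_one_of_measure_eq_inv_two (hm j) (hq.signs_symm T hT j j.2).1
        (hq.signs_symm T hT j j.2).2)]
    refine integral_congr_ae ?_
    filter_upwards [hq.ae_sum_eq x T] with ω hω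
    rw [hω]
  · intro T hT
    have h := (memLp_finsetSum Finset.univ fun (j : {j // j ∈ T}) _ =>
      (hL T hT j).const_mul (x j)).integrable_sq
    refine h.congr ?_
    filter_upwards [hq.ae_sum_eq x T] with ω hω
    rw [← hω]

end SparseSignVector

/-! ### From nets to the restricted isometry property -/

/-- The admissible constants form a closed set bounded below, so their infimum is attained. -/
theorem SatisfiesRIP.exists_isRestrictedIsometryConstant {M N K : ℕ} {A : Matrix (Fin M) (Fin N) ℝ}
    {δ : ℝ} (h : SatisfiesRIP A K δ) : ∃ δK, IsRestrictedIsometryConstant A K δK ∧ δK ≤ δ := by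
  have hcl : IsClosed {δ : ℝ | SatisfiesRIP A K δ} := by
    simp only [SatisfiesRIP, Set.ofPred_and, Set.ofPred_forall]
    refine (isClosed_le continuous_const continuous_id).inter
      (isClosed_iInter fun x => isClosed_iInter fun _ => ?_)
    exact (isClosed_le (by fun_prop) (by fun_prop)).inter (isClosed_le (by fun_prop) (by fun_prop))
  have hbdd : BddBelow {δ : ℝ | SatisfiesRIP A K δ} := ⟨0, fun _ h => h.1⟩
  exact ⟨_, hcl.isLeast_csInf ⟨δ, h⟩ hbdd, csInf_le hbdd h⟩

theorem sum_extend_sq {N : ℕ} (S : Finset (Fin N)) (y : EuclideanSpace ℝ {j // j ∈ S}) :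
    ∑ j, Function.extend Subtype.val y.ofLp 0 j ^ 2 = ‖y‖ ^ 2 := by
  rw [EuclideanSpace.real_norm_sq_eq]
  symm
  refine Fintype.sum_of_injective Subtype.val Subtype.val_injective _ _ ?_ ?_
  · intro j hj
    rw [Function.extend_apply' _ _ _ (by simpa using hj)]
    simp
  · intro j
    rw [Subtype.val_injective.extend_apply]

theorem satisfiesRIP_of_nets {M N K : ℕ} {A : Matrix (Fin M) (Fin N) ℝ} {δ : ℝ} (hδ : 0 ≤ δ)
    (hKN : K ≤ N) {s : ∀ S : Finset (Fin N), Finset (EuclideanSpace ℝ {j // j ∈ S})}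
    (hs1 : ∀ S, ∀ y ∈ s S, ‖y‖ = 1)
    (hs : ∀ S, ∀ x : EuclideanSpace ℝ {j // j ∈ S}, ‖x‖ = 1 → ∃ y ∈ s S, ‖x - y‖ ≤ 1 / 2)
    (h : ∀ S : Finset (Fin N), S.card = K → ∀ y ∈ s S,
      |‖WithLp.toLp 2 (A *ᵥ Function.extend Subtype.val y.ofLp 0)‖ ^ 2 - 1| ≤ δ / 32) :
    SatisfiesRIP A K δ := by
  classical
  refine ⟨hδ, fun x hx => ?_⟩
  -- Enlarging the support to exactly `K` indices means only `K`-subsets enter the union bound.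
  obtain ⟨S, hxS, hS⟩ := Finset.exists_superset_card_eq (s := (Function.support x).toFinset)
    (n := K) (by rwa [← Set.ncard_eq_toFinset_card']) (by simpa using hKN)
  let L : EuclideanSpace ℝ {j // j ∈ S} →ₗ[ℝ] EuclideanSpace ℝ (Fin M) :=
    (WithLp.linearEquiv 2 ℝ (Fin M → ℝ)).symm.toLinearMap ∘ₗ A.mulVecLin ∘ₗ
      Function.ExtendByZero.linearMap ℝ Subtype.val ∘ₗ
        (WithLp.linearEquiv 2 ℝ ({j // j ∈ S} → ℝ)).toLinearMap
  have hL : ∀ y, L y = WithLp.toLp 2 (A *ᵥ Function.extend Subtype.val y.ofLp 0) := fun y => rfl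
  let y : EuclideanSpace ℝ {j // j ∈ S} := WithLp.toLp 2 fun j => x j
  have hy : Function.extend Subtype.val y.ofLp 0 = x := by
    ext j
    by_cases hj : j ∈ S
    · exact Subtype.val_injective.extend_apply y.ofLp 0 ⟨j, hj⟩
    · rw [Function.extend_apply' _ _ _ (by simpa using hj)]
      by_contra hne
      exact hj (hxS (by simpa using Ne.symm hne))
  have hny : ‖y‖ ^ 2 = ‖WithLp.toLp 2 x‖ ^ 2 := by
    rw [← sum_extend_sq, hy, EuclideanSpace.real_norm_sq_eq]
  have key := abs_norm_sq_map_sub_norm_sq_le_of_net L (hs1 S) (hs S) (δ := δ)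
    (fun z hz => by
      rw [hs1 S z hz, one_pow, hL]
      exact h S hS z hz) y
  rw [hL, hy, hny, abs_le] at key
  constructor <;> linarith [key.1, key.2]

theorem norm_sq_smul_mulVec {M N : ℕ} {a : ℝ} (ha : 0 ≤ a) (Φ : Matrix (Fin M) (Fin N) ℝ)
    (x : Fin N → ℝ) :
    ‖WithLp.toLp 2 ((√a • Φ) *ᵥ x)‖ ^ 2 = a * ∑ i, (∑ j, x j * Φ i j) ^ 2 := by
  rw [EuclideanSpace.real_norm_sq_eq, Finset.mul_sum]
  refine Finset.sum_congr rfl fun i _ => ?_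
  have h : ((√a • Φ) *ᵥ x) i = √a * ∑ j, x j * Φ i j := by
    rw [Matrix.smul_mulVec, Pi.smul_apply, smul_eq_mul, Matrix.mulVec, dotProduct]
    exact congrArg _ (Finset.sum_congr rfl fun j _ => mul_comm _ _)
  change ((√a • Φ) *ᵥ x) i ^ 2 = _
  rw [h, mul_pow, Real.sq_sqrt ha]

/-! ### Deviation at a fixed vector and union bound -/

theorem IsSparseSensingMatrix.measure_deviation_le {Ω : Type*} [MeasurableSpace Ω] {μ : Measure Ω}
    [IsProbabilityMeasure μ] {M N k : ℕ} {Φ : Ω → Matrix (Fin M) (Fin N) ℝ}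
    (hΦ : IsSparseSensingMatrix μ k Φ) (hk : 1 ≤ k) (hkN : k ≤ N) (hM : 0 < M) {ε : ℝ}
    (hε : 0 ≤ ε) (hε1 : ε ≤ 1) {x : Fin N → ℝ} (hx : ∑ j, x j ^ 2 = 1) :
    μ.real {ω | ε ≤ |‖WithLp.toLp 2 ((√((N : ℝ) / (k * M)) • Φ ω) *ᵥ x)‖ ^ 2 - 1|} ≤
      2 * Real.exp (-(M * (k / N * ε) ^ 2 / 1024)) := by
  have hk0 : (0 : ℝ) < k := by exact_mod_cast hk
  have hN0 : (0 : ℝ) < N := by exact_mod_cast hk.trans hkN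
  have hM0 : (0 : ℝ) < M := by exact_mod_cast hM
  have hrow : ∀ i, Measurable fun ω => (Φ ω i : Fin N → ℝ) := fun i => (hΦ.rows i).measurable
  have hkN1 : (k : ℝ) / N ≤ 1 := (div_le_one hN0).2 (by exact_mod_cast hkN)
  have hind : iIndepFun (fun (i : Fin M) ω => ∑ j, x j * Φ ω i j) μ :=
    hΦ.rows_indep.comp (fun _ r => ∑ j, x j * r j) (fun _ => by fun_prop)
  -- Undoing the normalisation turns a deviation `ε` into `k / N * ε` per row; this is where the
  -- density of the rows affects the rate.
  have h := measure_abs_sum_sq_sub_ge_le (μ := μ) (p := k / N) (ε := k / N * ε)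
    (fun i => (hΦ.rows i).hasSubgaussianMGF hkN hx)
    (fun i => Finset.measurable_sum _ fun j _ =>
      ((measurable_pi_apply j).comp (hrow i)).const_mul (x j)) hind
    (fun i => by rw [(hΦ.rows i).integral_sq hk hkN, hx, mul_one]) (by positivity)
    (mul_le_one₀ hkN1 hε hε1)
  refine le_trans (measureReal_mono fun ω hω => ?_) h
  simp only [Set.mem_ofPred_eq] at hω ⊢
  rw [norm_sq_smul_mulVec (by positivity)] at hω
  have hrew : ∑ i, (∑ j, x j * Φ ω i j) ^ 2 - M * ((k : ℝ) / N) =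
      M * (k / N) * (N / (k * M) * ∑ i, (∑ j, x j * Φ ω i j) ^ 2 - 1) := by
    field_simp
  rw [hrew, abs_mul, abs_of_pos (by positivity), ← mul_assoc]
  gcongr

theorem choose_le_exp_mul_log {N K : ℕ} (hK : 1 ≤ K) (hKN : K ≤ N) :
    (N.choose K : ℝ) ≤ Real.exp (K * Real.log (Real.exp 1 * N / K)) := by
  have hK0 : (0 : ℝ) < K := by exact_mod_cast hK
  have hN0 : (0 : ℝ) < N := by exact_mod_cast hK.trans hKN
  have hf : (0 : ℝ) < K.factorial := by exact_mod_cast K.factorial_pos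
  rw [mul_comm, Real.exp_mul, Real.exp_log (by positivity), Real.rpow_natCast]
  refine (Nat.choose_le_pow_div K N).trans ?_
  -- `K ^ K / K! ≤ e ^ K` upgrades `N ^ K / K!` to `(e N / K) ^ K`.
  have h := Real.pow_div_factorial_le_exp K hK0.le K
  rw [div_pow, mul_pow, ← Real.exp_nat_mul, mul_one, div_le_div_iff₀ hf (by positivity)]
  rw [div_le_iff₀ hf] at h
  nlinarith [pow_pos hN0 K]

theorem five_pow_le_exp (K : ℕ) : (5 : ℝ) ^ K ≤ Real.exp (K * 2) := by
  rw [Real.exp_nat_mul]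
  gcongr
  have := Real.quadratic_le_exp_of_nonneg (x := 2) (by norm_num)
  linarith

theorem IsSparseSensingMatrix.measure_not_satisfiesRIP_le {Ω : Type*} [MeasurableSpace Ω]
    {μ : Measure Ω} [IsProbabilityMeasure μ] {M N k K : ℕ} {Φ : Ω → Matrix (Fin M) (Fin N) ℝ}
    (hΦ : IsSparseSensingMatrix μ k Φ) (hk : 1 ≤ k) (hkN : k ≤ N) (hM : 0 < M) (hKN : K ≤ N)
    {δ : ℝ} (hδ : 0 ≤ δ) (hδ1 : δ ≤ 1) :
    μ.real {ω | ¬ SatisfiesRIP (√((N : ℝ) / (k * M)) • Φ ω) K δ} ≤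
      N.choose K * (5 ^ K * (2 * Real.exp (-(M * (k / N * (δ / 32)) ^ 2 / 1024)))) := by
  choose s hcard hs1 hs using fun S : Finset (Fin N) =>
    exists_finset_half_net_sphere (EuclideanSpace ℝ {j // j ∈ S})
  set B : (Fin N → ℝ) → Set Ω := fun x =>
    {ω | δ / 32 ≤ |‖WithLp.toLp 2 ((√((N : ℝ) / (k * M)) • Φ ω) *ᵥ x)‖ ^ 2 - 1|}
  have hsub : {ω | ¬ SatisfiesRIP (√((N : ℝ) / (k * M)) • Φ ω) K δ} ⊆
      ⋃ S ∈ Finset.powersetCard K (Finset.univ : Finset (Fin N)), ⋃ y ∈ s S,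
        B (Function.extend Subtype.val y.ofLp 0) := by
    intro ω hω
    by_contra hcon
    simp only [Set.mem_iUnion, not_exists] at hcon
    refine hω (satisfiesRIP_of_nets hδ hKN hs1 hs fun S hS y hy => ?_)
    exact (not_le.1 (hcon S (Finset.mem_powersetCard.2 ⟨Finset.subset_univ S, hS⟩) y hy)).le
  refine (measureReal_mono hsub (measure_ne_top μ _)).trans ((measureReal_biUnion_finset_le _ _).trans ?_)
  have hS : ∀ S ∈ Finset.powersetCard K (Finset.univ : Finset (Fin N)),
      μ.real (⋃ y ∈ s S, B (Function.extend Subtype.val y.ofLp 0)) ≤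
        5 ^ K * (2 * Real.exp (-(M * (k / N * (δ / 32)) ^ 2 / 1024))) := by
    intro S hS
    refine (measureReal_biUnion_finset_le _ _).trans ?_
    refine (Finset.sum_le_card_nsmul _ _ _ fun y hy => hΦ.measure_deviation_le hk hkN hM
      (by positivity) (by linarith) (by rw [sum_extend_sq, hs1 S y hy, one_pow])).trans ?_
    rw [nsmul_eq_mul]
    gcongr
    have h := hcard S
    rw [finrank_euclideanSpace, Fintype.card_coe, (Finset.mem_powersetCard.1 hS).2] at h
    exact_mod_cast h
  refine (Finset.sum_le_card_nsmul _ _ _ hS).trans (le_of_eq ?_)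
  simp

/-! ### Choice of constants and conclusion -/

theorem theorem2 (ρ : ℝ) (hρ : 0 < ρ) :
    ∃ C c : ℝ, 0 < C ∧ 0 < c ∧
      ∀ {Ω : Type*} [MeasurableSpace Ω] (μ : Measure Ω) [IsProbabilityMeasure μ]
        (M N Kc K : ℕ) (δ : ℝ) (Φ : Ω → Matrix (Fin M) (Fin N) ℝ),
        1 ≤ Kc → Kc ≤ N → ρ ≤ (Kc : ℝ) / (N : ℝ) →
        IsSparseSensingMatrix μ Kc Φ →
        1 ≤ K → K ≤ N → 0 < δ → δ < 1 →
        C * (δ ^ 2)⁻¹ * (K : ℝ) * Real.log (Real.exp 1 * (N : ℝ) / (K : ℝ)) ≤ (M : ℝ) →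
        1 - 2 * Real.exp (-(c * δ ^ 2 * (M : ℝ))) <
          μ.real {ω | ∃ δK : ℝ, IsRestrictedIsometryConstant
            (Real.sqrt ((N : ℝ) / ((Kc : ℝ) * (M : ℝ))) • Φ ω) K δK ∧ δK ≤ δ} := by
  -- `1024 ^ 2 = 32 ^ 2 * 1024`: the net loss squared times the Chernoff constant.
  have hc0 : 0 < ρ ^ 2 / 1024 ^ 2 := by positivity
  set c₀ := ρ ^ 2 / 1024 ^ 2 with hc₀
  refine ⟨6 / c₀, c₀ / 4, by positivity, by positivity, ?_⟩
  intro Ω _ μ _ M N k K δ Φ hk hkN hρk hΦ hK hKN hδ hδ1 hM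
  have hK0 : (1 : ℝ) ≤ K := by exact_mod_cast hK
  have hKN' : (K : ℝ) ≤ N := by exact_mod_cast hKN
  have hN0 : (0 : ℝ) < N := by linarith
  set l := Real.log (Real.exp 1 * (N : ℝ) / (K : ℝ)) with hl
  have hl1 : 1 ≤ l := by
    rw [hl, Real.le_log_iff_exp_le (by positivity), le_div_iff₀ (by positivity)]
    gcongr
  have hMpos : (0 : ℝ) < M := lt_of_lt_of_le (by positivity) hM
  have hKl : 6 * (K * l) ≤ c₀ * δ ^ 2 * M := by
    have : 6 / c₀ * (δ ^ 2)⁻¹ * K * l = 6 * (K * l) / (c₀ * δ ^ 2) := by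
      field_simp
    rw [this, div_le_iff₀ (by positivity)] at hM
    linarith
  have hbad := hΦ.measure_not_satisfiesRIP_le (K := K) hk hkN (by exact_mod_cast hMpos) hKN
    hδ.le hδ1.le
  have hexp : Real.exp (-(M * (k / N * (δ / 32)) ^ 2 / 1024)) ≤ Real.exp (-(c₀ * δ ^ 2 * M)) := by
    have h1 : ρ ^ 2 ≤ ((k : ℝ) / N) ^ 2 := by gcongr
    have h2 := mul_le_mul_of_nonneg_right h1 (show 0 ≤ δ ^ 2 * M / 1024 ^ 2 by positivity)
    refine Real.exp_le_exp.2 (neg_le_neg ?_)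
    calc c₀ * δ ^ 2 * M = ρ ^ 2 * (δ ^ 2 * M / 1024 ^ 2) := by rw [hc₀]; ring
      _ ≤ _ := h2
      _ = _ := by ring
  have hbound : μ.real {ω | ¬ SatisfiesRIP (√((N : ℝ) / (k * M)) • Φ ω) K δ} <
      2 * Real.exp (-(c₀ / 4 * δ ^ 2 * M)) := by
    calc _ ≤ _ := hbad
      _ ≤ Real.exp (K * l) * (Real.exp (K * 2) * (2 * Real.exp (-(c₀ * δ ^ 2 * M)))) := by
        gcongr
        · exact choose_le_exp_mul_log hK hKN
        · exact five_pow_le_exp K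
      _ = 2 * Real.exp (K * l + K * 2 + -(c₀ * δ ^ 2 * M)) := by
        rw [Real.exp_add, Real.exp_add]; ring
      _ < _ := by
        gcongr
        -- Since `l ≥ 1`, the entropy `K l + 2 K` is at most `3 K l`, half of `c₀ δ² M` by the
        -- choice of `C`. Keeping a quarter rather than the remaining half makes the inequality
        -- strict.
        have : 0 < c₀ * δ ^ 2 * M := by positivity
        nlinarith
  have hcover : 1 ≤ μ.real {ω | SatisfiesRIP (√((N : ℝ) / (k * M)) • Φ ω) K δ} +
      μ.real {ω | ¬ SatisfiesRIP (√((N : ℝ) / (k * M)) • Φ ω) K δ} := by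
    refine le_trans (le_of_eq ?_) (measureReal_union_le _ _)
    rw [← probReal_univ (μ := μ)]
    congr 1
    ext ω
    simpa using em _
  have hmono : μ.real {ω | SatisfiesRIP (√((N : ℝ) / (k * M)) • Φ ω) K δ} ≤
      μ.real {ω | ∃ δK : ℝ, IsRestrictedIsometryConstant (√((N : ℝ) / (k * M)) • Φ ω) K δK ∧
        δK ≤ δ} :=
    measureReal_mono fun ω hω => SatisfiesRIP.exists_isRestrictedIsometryConstant hω
  linarith
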